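/- Let $R$ be an associative ring with identity, with Jacobson radical $J(R)$. A \emph{right coprime pair} $\langle a,b\rangle$ of $R$ is given by elements $a,b\in R$ with $aR+bR=R$, where $\langle a,b\rangle$ and $\langle a',b'\rangle$ are identified if and only if $aR=a'R$ and $bR=b'R$; in this case $(a',b')$ is called a pair of generators of $\langle a,b\rangle$. The set $\mathrm{RCP}(R)$ of right coprime pairs is partially ordered by $\langle a,b\rangle\le\langle a',b'\rangle$ if and only if $aR\subseteq a'R$ and $bR\subseteq b'R$. A \emph{descending system} of right coprime pairs is a family $\{p_i\}_{i\in I}$ in $\mathrm{RCP}(R)$ indexed by a (non-empty, partially ordered) directed set $I$ such that $p_j\le p_i$ whenever $i\le j$. It is \emph{compatible} if there are pairs of generators $(a_i,b_i)$ of $p_i$ for $i\in I$ and families $\{r_{ij}\mid i<j\}$, $\{s_{ij}\mid i<j\}$ of elements of $R$ such that $a_j=a_ir_{ij}$ and $b_j=b_is_{ij}$ for all $i<j$, and $r_{ik}=r_{ij}r_{jk}$ and $s_{ik}=s_{ij}s_{jk}$ for all $i<j<k$ in $I$. A \emph{minimal lower bound} of the system is a lower bound of it in $\mathrm{RCP}(R)$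 which is a minimal element of $\mathrm{RCP}(R)$. Suppose that every compatible descending system of right coprime pairs of $R$ has a minimal lower bound. Then the ring $R/J(R)$ is left continuous; that is, as a left module over itself it satisfies: (C1) every submodule is essential in a direct summand; and (C2) every submodule isomorphic to a direct summand is itself a direct summand. -/

import Mathlib

universe u

/-- The principal right ideal `aR`. Right ideals of `R` are the submodules of `R` over `Rᵐᵒᵖ`,
which acts on `R` by right multiplication. -/
def rightPrincipal {R : Type u} [Ring R] (a : R) : Submodule Rᵐᵒᵖ R :=
  Submodule.span Rᵐᵒᵖ {a}

/-- A pair of elements `fst`, `snd` of `R` with `fst R + snd R = R`. -/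
structure CoprimeGenerators (R : Type u) [Ring R] where
  fst : R
  snd : R
  coprime : rightPrincipal fst ⊔ rightPrincipal snd = ⊤

/-- `(a, b) ≤ (a', b')` when `aR ⊆ a'R` and `bR ⊆ b'R`. -/
instance CoprimeGenerators.instPreorder (R : Type u) [Ring R] : Preorder (CoprimeGenerators R) where
  le p q := rightPrincipal p.fst ≤ rightPrincipal q.fst ∧ rightPrincipal p.snd ≤ rightPrincipal q.snd
  le_refl _ := ⟨le_rfl, le_rfl⟩
  le_trans _ _ _ h k := ⟨h.1.trans k.1, h.2.trans k.2⟩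

/-- The partially ordered set of right coprime pairs of `R`: pairs of elements `(a, b)` with
`aR + bR = R`, where `(a, b)` and `(a', b')` are identified if and only if `aR = a'R` and
`bR = b'R` (that is, each is `≤` the other), with the order induced from `CoprimeGenerators R`. -/
abbrev RCP (R : Type u) [Ring R] : Type u :=
  Antisymmetrization (CoprimeGenerators R) (· ≤ ·)

/-- The right coprime pair `⟨a, b⟩` with the given pair of generators. -/
def CoprimeGenerators.toRCP {R : Type u} [Ring R] (g : CoprimeGenerators R) : RCP R :=
  toAntisymmetrization (· ≤ ·) g

/-- Two pairs of generators give the same right coprime pair iff they generate the same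
right ideals. -/
theorem CoprimeGenerators.toRCP_eq_iff {R : Type u} [Ring R] (g h : CoprimeGenerators R) :
    g.toRCP = h.toRCP ↔
      rightPrincipal g.fst = rightPrincipal h.fst ∧ rightPrincipal g.snd = rightPrincipal h.snd := by
  constructor
  · intro e
    have k : AntisymmRel (· ≤ ·) g h := Quotient.exact e
    exact ⟨le_antisymm k.1.1 k.2.1, le_antisymm k.1.2 k.2.2⟩
  · rintro ⟨h1, h2⟩
    exact Quotient.sound ⟨⟨h1.le, h2.le⟩, ⟨h1.ge, h2.ge⟩⟩

/-- A family `p` of right coprime pairs, indexed by a partially ordered set `I`, is compatible if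
generators `(aᵢ, bᵢ)` of the pairs `pᵢ` and scalars `r i j`, `s i j` for `i < j` can be chosen with
`aⱼ = aᵢ r i j`, `bⱼ = bᵢ s i j` for `i < j`, and `r i k = r i j * r j k`, `s i k = s i j * s j k`
for `i < j < k`. (The values of `r` and `s` at other pairs of indices are irrelevant.) -/
def IsCompatibleFamily {R : Type u} [Ring R] {I : Type u} [PartialOrder I] (p : I → RCP R) : Prop :=
  ∃ (g : I → CoprimeGenerators R) (r s : I → I → R),
    (∀ i, (g i).toRCP = p i) ∧
    (∀ i j, i < j → (g j).fst = (g i).fst * r i j ∧ (g j).snd = (g i).snd * s i j) ∧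
    (∀ i j k, i < j → j < k → r i k = r i j * r j k ∧ s i k = s i j * s j k)

/-- Every compatible descending system of right coprime pairs in `R` has a minimal lower bound,
i.e. a lower bound that is a minimal element of `RCP R`. A descending system is an order-reversing
family of right coprime pairs indexed by a directed partially ordered set. -/
def CompatibleSystemsHaveMinimalLowerBounds (R : Type u) [Ring R] : Prop :=
  ∀ (I : Type u) [PartialOrder I] [Nonempty I] [IsDirectedOrder I] (p : I → RCP R),
    Antitone p → IsCompatibleFamily p →
      ∃ m : RCP R, m ∈ lowerBounds (Set.range p) ∧ IsMin m

/-- `N` is an essential submodule of `K`: it is contained in `K` and meets every nonzero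
submodule of `K` nontrivially. -/
def IsEssentialIn {A M : Type*} [Ring A] [AddCommGroup M] [Module A M]
    (N K : Submodule A M) : Prop :=
  N ≤ K ∧ ∀ L : Submodule A M, L ≤ K → N ⊓ L = ⊥ → L = ⊥

/-- A left module is continuous if every submodule is essential in a direct summand (C1), and
every submodule isomorphic to a direct summand is itself a direct summand (C2). Direct summands
are the complemented submodules. -/
structure IsContinuousModule (A M : Type*) [Ring A] [AddCommGroup M] [Module A M] : Prop where
  c1 : ∀ N : Submodule A M, ∃ K : Submodule A M, IsComplemented K ∧ IsEssentialIn N K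
  c2 : ∀ N K : Submodule A M, IsComplemented K → Nonempty (N ≃ₗ[A] K) → IsComplemented N

/-- A ring is left continuous if it is continuous as a left module over itself. -/
def IsLeftContinuousRing (A : Type*) [Ring A] : Prop :=
  IsContinuousModule A A

/-! ### One-sided invertibility and the Jacobson radical. -/

section Jacobson

variable {R : Type u} [Ring R]

/-! A minimal right coprime pair lies above some `⟨e, 1 - e⟩` with `e` idempotent, so every
compatible system has a lower bound of that form (`exists_isIdempotentElem`). If idempotents `eᵢ`
have increasing left ideals `R eᵢ`, then `(1 - eᵢ)(1 - eⱼ) = 1 - eⱼ` for `i < j`, so the elements `1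
- eᵢ` form a compatible family with `r i j = 1 - eⱼ`. A lower bound `f` satisfies `eᵢ f = 0`: all `R
eᵢ` lie in `R (1 - f)`. Applied to chains, this makes `R/J` regular, which gives (C2). For (C1),
take disjoint left ideals `N`, `M` of `R/J`, and approximate their preimages, essentially modulo
`J`, by directed systems of idempotents `E`, `G` (`exists_directedOn`). The pairs `⟨1 - E, 1 - G⟩`
are coprime, and a lower bound `⟨f, 1 - f⟩` yields an idempotent `1 - f` fixing `N` and killing `M`
modulo `J`. With `M` maximal, `N` is essential in the summand that it generates. -/

theorem mem_jacobson_of_forall_rightInverse {c : R} (H : ∀ s, ∃ v, (1 - c * s) * v = 1) :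
    c ∈ Ring.jacobson R := by
  rw [← Ideal.jacobson_bot, Ideal.mem_jacobson_iff]
  intro y
  obtain ⟨v, hv⟩ := H (-y)
  -- `v = 1 - c * (y * v)` is right invertible too, so `1 + c * y` is its two-sided inverse.
  obtain ⟨w, hw⟩ := H (y * v)
  have hv' : (1 + c * y) * v = 1 := by simpa using hv
  have e1 : 1 - c * (y * v) = v := by
    rw [sub_eq_iff_eq_add, ← hv']; noncomm_ring
  rw [e1] at hw
  have hw' : w = 1 + c * y := by
    calc w = ((1 + c * y) * v) * w := by rw [hv', one_mul]
      _ = 1 + c * y := by rw [mul_assoc, hw, mul_one]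
  rw [hw'] at hw
  refine ⟨1 - y * v * c, ?_⟩
  rw [Submodule.mem_bot]
  have : (1 - y * v * c) * y * c + (1 - y * v * c) - 1
      = y * c - y * (v * (1 + c * y)) * c := by noncomm_ring
  rw [this, hw]; noncomm_ring

theorem exists_inverse_one_sub_of_mem_jacobson {j : R} (hj : j ∈ Ring.jacobson R) :
    ∃ v, (1 - j) * v = 1 ∧ v * (1 - j) = 1 := by
  have key : ∀ i ∈ Ring.jacobson R, ∃ z, z * (1 - i) = 1 := by
    intro i hi
    rw [← Ideal.jacobson_bot, Ideal.mem_jacobson_iff] at hi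
    obtain ⟨z, hz⟩ := hi (-1)
    rw [Submodule.mem_bot, sub_eq_zero] at hz
    exact ⟨z, by simpa [mul_add, sub_eq_add_neg, add_comm] using hz⟩
  obtain ⟨z, hz⟩ := key j hj
  obtain ⟨w, hw⟩ := key (-(z * j)) (neg_mem (Ideal.mul_mem_left _ z hj))
  have e1 : 1 - -(z * j) = z := by
    rw [mul_sub, mul_one, sub_eq_iff_eq_add] at hz
    rw [sub_neg_eq_add, ← hz]
  rw [e1] at hw
  have : w = 1 - j := by
    calc w = w * (z * (1 - j)) := by rw [hz, mul_one]
      _ = 1 - j := by rw [← mul_assoc, hw, one_mul]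
  exact ⟨z, this ▸ hw, hz⟩

end Jacobson

/-! ### Minimal coprime pairs and the idempotents below compatible systems. -/

section MinimalPairs

variable {R : Type u} [Ring R]

theorem isIdempotentElem_of_minimal {e : R}
    (hmin : ∀ p q : R, (∃ u v, e * p * u + (1 - e) * q * v = 1) →
      (∃ t, e = e * p * t) ∧ ∃ t, 1 - e = (1 - e) * q * t) : IsIdempotentElem e := by
  have hJ : e * (1 - e) ∈ Ring.jacobson R := by
    apply mem_jacobson_of_forall_rightInverse
    intro s
    -- This `p` satisfies `e * p = (1 - e * (1 - e) * s) * e`, so `e` is a right multiple of the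
    -- element to be inverted.
    obtain ⟨⟨t, ht⟩, -⟩ := hmin (1 - (1 - e) * (s * e)) 1 ⟨1, 1 + e * (s * e), by noncomm_ring⟩
    have hz : e = (1 - e * (1 - e) * s) * (e * t) := by
      conv_lhs => rw [ht]
      noncomm_ring
    refine ⟨1 + e * t * ((1 - e) * s), ?_⟩
    calc _ = (1 - e * (1 - e) * s) + ((1 - e * (1 - e) * s) * (e * t)) * ((1 - e) * s) := by
          noncomm_ring
      _ = 1 := by rw [← hz]; noncomm_ring
  -- The coefficients come from `e² (3 - 2e) + (1 - e)² (1 + 2e) = 1`.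
  obtain ⟨⟨t, ht⟩, ⟨s, hs⟩⟩ := hmin e (1 - e) ⟨1 + 2 * (1 - e), 1 + 2 * e, by noncomm_ring⟩
  have he : e * (e * t) = e := by rw [← mul_assoc, ← ht]
  have he' : (1 - e) * ((1 - e) * s) = 1 - e := by rw [← mul_assoc, ← hs]
  have hn : e * e * t - e * t ∈ Ring.jacobson R := by
    have : e * e * t - e * t = -(e * (1 - e) * t) := by noncomm_ring
    rw [this]
    exact neg_mem (Ideal.mul_mem_right _ _ hJ)
  have hm : (1 - e) * (1 - e) * s - (1 - e) * s ∈ Ring.jacobson R := by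
    have : (1 - e) * (1 - e) * s - (1 - e) * s = -(e * (1 - e) * s) := by noncomm_ring
    rw [this]
    exact neg_mem (Ideal.mul_mem_right _ _ hJ)
  rw [← ht] at hn
  rw [← hs] at hm
  obtain ⟨v, hv, -⟩ := exists_inverse_one_sub_of_mem_jacobson (neg_mem (add_mem hn hm))
  -- `m + n` is right invertible, being `1` modulo the radical, and `e * e` and `e` agree on it
  -- because `e * n = 0` and `e * m = m`.
  set n := 1 - e * t with hn_def
  set m := 1 - (1 - e) * s with hm_def
  have hmn : 1 - -(e - e * t + (1 - e - (1 - e) * s)) = m + n := by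
    rw [hn_def, hm_def]; noncomm_ring
  rw [hmn] at hv
  have en : e * n = 0 := by rw [hn_def, mul_sub, mul_one, he, sub_self]
  have em : e * m = m := by
    have : (1 - e) * m = 0 := by rw [hm_def, mul_sub, mul_one, he', sub_self]
    rw [sub_mul, one_mul, sub_eq_zero] at this
    exact this.symm
  have e1 : e * (m + n) = m := by rw [mul_add, en, em, add_zero]
  calc e * e = e * (e * (m + n)) * v := by rw [mul_assoc, mul_assoc, hv, mul_one]
    _ = e * (m + n) * v := by rw [e1, em]
    _ = e := by rw [mul_assoc, hv, mul_one]

theorem mem_rightPrincipal_iff {a x : R} : x ∈ rightPrincipal a ↔ ∃ t, x = a * t := by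
  rw [rightPrincipal, Submodule.mem_span_singleton]
  constructor
  · rintro ⟨t, rfl⟩
    exact ⟨t.unop, rfl⟩
  · rintro ⟨t, rfl⟩
    exact ⟨MulOpposite.op t, rfl⟩

theorem rightPrincipal_le_iff {a b : R} :
    rightPrincipal a ≤ rightPrincipal b ↔ ∃ t, a = b * t := by
  rw [← mem_rightPrincipal_iff]
  conv_lhs => rw [rightPrincipal, Submodule.span_singleton_le_iff_mem]

theorem rightPrincipal_sup_eq_top_iff {a b : R} :
    rightPrincipal a ⊔ rightPrincipal b = ⊤ ↔ ∃ u v, a * u + b * v = 1 := by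
  constructor
  · intro h
    have h1 : (1 : R) ∈ rightPrincipal a ⊔ rightPrincipal b := h ▸ Submodule.mem_top
    obtain ⟨x, hx, y, hy, hxy⟩ := Submodule.mem_sup.1 h1
    obtain ⟨u, rfl⟩ := mem_rightPrincipal_iff.1 hx
    obtain ⟨v, rfl⟩ := mem_rightPrincipal_iff.1 hy
    exact ⟨u, v, hxy⟩
  · rintro ⟨u, v, h⟩
    rw [eq_top_iff]
    intro x _
    refine Submodule.mem_sup.2 ⟨a * (u * x), mem_rightPrincipal_iff.2 ⟨_, rfl⟩, b * (v * x),
      mem_rightPrincipal_iff.2 ⟨_, rfl⟩, ?_⟩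
    rw [← mul_assoc, ← mul_assoc, ← add_mul, h, one_mul]

/-- A minimal right coprime pair is of the form `⟨e, 1 - e⟩` with `e` idempotent. -/
theorem exists_isIdempotentElem_of_isMin {g : CoprimeGenerators R} (hg : IsMin g.toRCP) :
    ∃ e, IsIdempotentElem e ∧ (∃ x, e = g.fst * x) ∧ ∃ y, 1 - e = g.snd * y := by
  obtain ⟨x, y, hxy⟩ := rightPrincipal_sup_eq_top_iff.1 g.coprime
  have h1 : 1 - g.fst * x = g.snd * y := by rw [← hxy, add_sub_cancel_left]
  refine ⟨g.fst * x, isIdempotentElem_of_minimal ?_, ⟨x, rfl⟩, y, h1⟩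
  rintro p q ⟨u, v, huv⟩
  let g' : CoprimeGenerators R := ⟨g.fst * x * p, (1 - g.fst * x) * q,
    rightPrincipal_sup_eq_top_iff.2 ⟨u, v, huv⟩⟩
  have hle : g'.toRCP ≤ g.toRCP :=
    ⟨rightPrincipal_le_iff.2 ⟨x * p, mul_assoc _ _ _⟩,
      rightPrincipal_le_iff.2 ⟨y * q, by rw [← mul_assoc, ← h1]⟩⟩
  have hge : g ≤ g' := hg hle
  obtain ⟨s, hs⟩ := rightPrincipal_le_iff.1 hge.1
  obtain ⟨t, ht⟩ := rightPrincipal_le_iff.1 hge.2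
  refine ⟨⟨s * x, ?_⟩, t * y, ?_⟩
  · rw [← mul_assoc]
    exact congrArg (· * x) hs
  · rw [← mul_assoc]
    exact h1.trans (congrArg (· * y) ht)

/-- A compatible descending system of right coprime pairs `⟨aᵢ, bᵢ⟩` has a lower bound
`⟨e, 1 - e⟩` with `e` idempotent. -/
theorem CompatibleSystemsHaveMinimalLowerBounds.exists_isIdempotentElem
    (h : CompatibleSystemsHaveMinimalLowerBounds R) {I : Type u} [PartialOrder I] [Nonempty I]
    [IsDirectedOrder I] (a b : I → R) (r s : I → I → R)
    (hab : ∀ i, ∃ u v, a i * u + b i * v = 1)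
    (ha : ∀ i j, i < j → a j = a i * r i j) (hb : ∀ i j, i < j → b j = b i * s i j)
    (hr : ∀ i j k, i < j → j < k → r i k = r i j * r j k)
    (hs : ∀ i j k, i < j → j < k → s i k = s i j * s j k) :
    ∃ e, IsIdempotentElem e ∧ ∀ i, (∃ x, e = a i * x) ∧ ∃ y, 1 - e = b i * y := by
  let g : I → CoprimeGenerators R := fun i =>
    ⟨a i, b i, rightPrincipal_sup_eq_top_iff.2 (hab i)⟩
  obtain ⟨m, hm, hmin⟩ := h I (fun i => (g i).toRCP)
    (by
      intro i j hij
      obtain rfl | hlt := eq_or_lt_of_le hij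
      · exact le_rfl
      · exact ⟨rightPrincipal_le_iff.2 ⟨_, ha i j hlt⟩, rightPrincipal_le_iff.2 ⟨_, hb i j hlt⟩⟩)
    ⟨g, r, s, fun _ => rfl, fun i j hij => ⟨ha i j hij, hb i j hij⟩,
      fun i j k hij hjk => ⟨hr i j k hij hjk, hs i j k hij hjk⟩⟩
  induction m using Quotient.inductionOn with
  | h m =>
    obtain ⟨e, he, ⟨x, hx⟩, y, hy⟩ := exists_isIdempotentElem_of_isMin (g := m) hmin
    refine ⟨e, he, fun i => ?_⟩
    have hle : m ≤ g i := hm ⟨i, rfl⟩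
    obtain ⟨p, hp⟩ := rightPrincipal_le_iff.1 hle.1
    obtain ⟨q, hq⟩ := rightPrincipal_le_iff.1 hle.2
    exact ⟨⟨p * x, by rw [hx, hp, mul_assoc]⟩, q * y, by rw [hy, hq, mul_assoc]⟩

/-- `R` is an exchange ring. -/
theorem CompatibleSystemsHaveMinimalLowerBounds.exists_isIdempotentElem_of_coprime
    (h : CompatibleSystemsHaveMinimalLowerBounds R) {a b : R} (hab : ∃ u v, a * u + b * v = 1) :
    ∃ e, IsIdempotentElem e ∧ (∃ x, e = a * x) ∧ ∃ y, 1 - e = b * y := by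
  obtain ⟨e, he, H⟩ := h.exists_isIdempotentElem (I := PUnit) (fun _ => a) (fun _ => b)
    (fun _ _ => 1) (fun _ _ => 1) (fun _ => hab) (by simp) (by simp) (by simp) (by simp)
  exact ⟨e, he, H ⟨⟩⟩

theorem CompatibleSystemsHaveMinimalLowerBounds.exists_isIdempotentElem_ne_zero
    (h : CompatibleSystemsHaveMinimalLowerBounds R) {c : R} (hc : c ∉ Ring.jacobson R) :
    ∃ e, IsIdempotentElem e ∧ e ≠ 0 ∧ ∃ x, e = c * x := by
  by_contra! H
  refine hc (mem_jacobson_of_forall_rightInverse fun s => ?_)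
  obtain ⟨e, he, ⟨x, hx⟩, y, hy⟩ :=
    h.exists_isIdempotentElem_of_coprime (a := c * s) (b := 1 - c * s) ⟨1, 1, by noncomm_ring⟩
  have h0 : e = 0 := by
    by_contra h0
    exact H e he h0 (s * x) (by rw [hx, mul_assoc])
  exact ⟨y, by rw [← hy, h0, sub_zero]⟩

end MinimalPairs

/-! ### Left ideals generated by idempotents. -/

section Idempotents

variable {R : Type u} [Ring R]

theorem mul_eq_self_of_mem_span {x e : R} (he : IsIdempotentElem e)
    (hx : x ∈ Ideal.span {e}) : x * e = x := by
  obtain ⟨a, rfl⟩ := Ideal.mem_span_singleton'.1 hx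
  rw [mul_assoc, he.eq]

theorem mul_eq_self_of_span_le {x e : R} (he : IsIdempotentElem e)
    (hx : Ideal.span {x} ≤ Ideal.span {e}) : x * e = x :=
  mul_eq_self_of_mem_span he (hx (Ideal.mem_span_singleton_self x))

theorem span_le_span_of_mul_eq {x e : R} (h : x * e = x) :
    Ideal.span {x} ≤ Ideal.span {e} := by
  rw [Ideal.span_singleton_le_iff_mem, Ideal.mem_span_singleton']
  exact ⟨x, h⟩

theorem IsIdempotentElem.isComplemented_span {e : R} (he : IsIdempotentElem e) :
    IsComplemented (Ideal.span {e}) := by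
  refine ⟨Ideal.span {1 - e}, ?_, ?_⟩
  · rw [Submodule.disjoint_def]
    intro x h1 h2
    have h1 := mul_eq_self_of_mem_span he h1
    have h2 := mul_eq_self_of_mem_span he.one_sub h2
    rw [mul_sub, mul_one, h1, sub_self] at h2
    exact h2.symm
  · rw [codisjoint_iff, Ideal.eq_top_iff_one]
    exact Submodule.mem_sup.2 ⟨e, Ideal.mem_span_singleton_self e, 1 - e,
      Ideal.mem_span_singleton_self _, by abel⟩

theorem exists_forall_mul_eq_of_isComplemented {L : Ideal R} (hL : IsComplemented L) :
    ∃ e ∈ L, ∀ x ∈ L, x * e = x := by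
  obtain ⟨M, hM⟩ := hL
  have h1 : (1 : R) ∈ L ⊔ M := by rw [hM.sup_eq_top]; exact Submodule.mem_top
  obtain ⟨e, he, f, hf, hef⟩ := Submodule.mem_sup.1 h1
  refine ⟨e, he, fun x hx => ?_⟩
  have hxf : x * f = x - x * e := by
    rw [eq_sub_iff_add_eq', ← mul_add, hef, mul_one]
  have hxf' : x * f ∈ L := hxf ▸ sub_mem hx (L.mul_mem_left x he)
  have := (Submodule.disjoint_def.1 hM.disjoint) _ hxf' (M.mul_mem_left x hf)
  rw [this] at hxf
  exact (sub_eq_zero.1 hxf.symm).symm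

theorem IsIdempotentElem.notMem_jacobson {e : R} (he : IsIdempotentElem e) (h0 : e ≠ 0) :
    e ∉ Ring.jacobson R := by
  intro hJ
  obtain ⟨v, hv, -⟩ := exists_inverse_one_sub_of_mem_jacobson hJ
  apply h0
  calc e = e * ((1 - e) * v) := by rw [hv, mul_one]
    _ = 0 := by rw [← mul_assoc, mul_sub, mul_one, he.eq, sub_self, zero_mul]

/-- If `x (1 - e) R` contains `x`, the sum of the left ideals generated by the idempotents `e` and
`x` is generated by an idempotent. -/
theorem exists_span_sup_span_eq {e x : R} (he : IsIdempotentElem e) (hx : IsIdempotentElem x)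
    (h : ∃ t, x * (1 - e) * t = x) :
    ∃ f, IsIdempotentElem f ∧ Ideal.span {e} ⊔ Ideal.span {x} = Ideal.span {f} := by
  obtain ⟨t, ht⟩ := h
  -- `g` is an idempotent generating the left ideal of `x * (1 - e)`, with `g * e = 0`; replacing it
  -- by `(1 - e) * g` makes it orthogonal to `e` on both sides.
  obtain ⟨g, hg⟩ : ∃ g, g = t * x * (1 - e) := ⟨_, rfl⟩
  have hge : g * e = 0 := by
    rw [hg, mul_assoc, sub_mul, one_mul, he.eq, sub_self, mul_zero]
  have hxg : x * (1 - e) * g = x * (1 - e) := by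
    calc x * (1 - e) * g = (x * (1 - e) * t) * x * (1 - e) := by rw [hg]; noncomm_ring
      _ = x * (1 - e) := by rw [ht, hx.eq]
  have hgg : g * g = g := by
    calc g * g = t * (x * (1 - e) * g) := by nth_rewrite 1 [hg]; noncomm_ring
      _ = g := by rw [hxg, hg, mul_assoc]
  have hee : e * (e + (1 - e) * g) = e := by
    rw [mul_add, ← mul_assoc, mul_sub, mul_one, he.eq, sub_self, zero_mul, add_zero]
  have hgf : g * (e + (1 - e) * g) = g := by
    rw [mul_add, ← mul_assoc, mul_sub, mul_one, hge, sub_zero, zero_add, hgg]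
  have hxf : x * (e + (1 - e) * g) = x := by
    rw [mul_add, ← mul_assoc, hxg]; noncomm_ring
  refine ⟨e + (1 - e) * g, ?_, le_antisymm ?_ ?_⟩
  · rw [IsIdempotentElem, add_mul, hee, mul_assoc, hgf]
  · exact sup_le (span_le_span_of_mul_eq hee) (span_le_span_of_mul_eq hxf)
  · rw [Ideal.span_singleton_le_iff_mem]
    have : e + (1 - e) * g = (1 - (1 - e) * t * x) * e + (1 - e) * t * x := by
      rw [hg]; noncomm_ring
    rw [this]
    exact Submodule.add_mem_sup (Ideal.mul_mem_left _ _ (Ideal.mem_span_singleton_self e))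
      (Ideal.mul_mem_left _ _ (Ideal.mem_span_singleton_self x))

end Idempotents

/-! ### Regularity modulo the radical and directed systems of idempotents. -/

section Regularity

variable {R : Type u} [Ring R]

namespace CompatibleSystemsHaveMinimalLowerBounds

theorem exists_mul_isIdempotentElem_ne_zero
    (h : CompatibleSystemsHaveMinimalLowerBounds R) {c : R} (hc : c ∉ Ring.jacobson R) :
    ∃ s, IsIdempotentElem (s * c) ∧ s * c ≠ 0 := by
  obtain ⟨e, he, h0, x, hx⟩ := h.exists_isIdempotentElem_ne_zero hc
  refine ⟨x * e, ?_, fun H => h0 ?_⟩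
  · calc x * e * c * (x * e * c) = x * e * (c * x) * e * c := by noncomm_ring
      _ = x * e * c := by rw [← hx, mul_assoc x e e, he.eq, mul_assoc x e e, he.eq]
  · calc e = (c * x) * e * (c * x) := by rw [← hx, he.eq, he.eq]
      _ = c * (x * e * c) * x := by noncomm_ring
      _ = 0 := by rw [H, mul_zero, zero_mul]

/-- `R` is von Neumann regular modulo its Jacobson radical. -/
theorem exists_isIdempotentElem_one_sub_mul_mem (h : CompatibleSystemsHaveMinimalLowerBounds R)
    (c : R) : ∃ e, IsIdempotentElem e ∧ (∃ x, e = c * x) ∧ (1 - e) * c ∈ Ring.jacobson R := by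
  obtain ⟨M, ⟨e, he, ⟨z, hz⟩, rfl⟩, hmax⟩ := zorn_le₀
    {L : Ideal R | ∃ e, IsIdempotentElem e ∧ (∃ x, e = c * x) ∧ L = Ideal.span {e}} (by
      intro C hCS hC
      obtain rfl | hne := C.eq_empty_or_nonempty
      · exact ⟨Ideal.span {0}, ⟨0, .zero, ⟨0, by simp⟩, rfl⟩, by simp⟩
      choose E hE hx hEL using fun L : C => hCS L.2
      choose x hx using hx
      have hne' : Nonempty C := hne.to_subtype
      have hdir : IsDirectedOrder C := ⟨fun a b => (hC.total a.2 b.2).elim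
        (fun hab => ⟨b, hab, le_rfl⟩) (fun hab => ⟨a, le_rfl, hab⟩)⟩
      have hmul : ∀ i j : C, i ≤ j → E i * E j = E i := fun i j hij =>
        mul_eq_self_of_span_le (hE j) (by rw [← hEL, ← hEL]; exact hij)
      have hmul' : ∀ i j : C, i < j → 1 - E j = (1 - E i) * (1 - E j) := fun i j hij => by
        rw [sub_mul, one_mul, mul_sub, mul_one, hmul i j hij.le, sub_self, sub_zero]
      -- The constant second entry `c` keeps `1 - f` in `cR`, so the upper bound of the chain is
      -- again of the required kind.
      obtain ⟨f, hf, H⟩ := h.exists_isIdempotentElem (fun i : C => 1 - E i) (fun _ => c)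
        (fun _ j => 1 - E j) (fun _ _ => 1)
        (fun i => ⟨1, x i, by rw [← hx, mul_one, sub_add_cancel]⟩) hmul' (by simp)
        (fun i j k _ hjk => hmul' j k hjk) (by simp)
      refine ⟨Ideal.span {1 - f}, ⟨1 - f, hf.one_sub, (H hne'.some).2, rfl⟩, fun L hL => ?_⟩
      obtain ⟨y, hy⟩ := (H ⟨L, hL⟩).1
      refine (hEL ⟨L, hL⟩).le.trans ?_
      apply span_le_span_of_mul_eq
      rw [mul_sub, mul_one, hy, ← mul_assoc, mul_sub, mul_one, (hE _).eq, sub_self, zero_mul,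
        sub_zero])
  refine ⟨e, he, ⟨z, hz⟩, ?_⟩
  by_contra hJ
  obtain ⟨g, hg, h0, x, hx⟩ := h.exists_isIdempotentElem_ne_zero hJ
  have heg : e * g = 0 := by
    rw [hx, ← mul_assoc, ← mul_assoc, mul_sub, mul_one, he.eq, sub_self, zero_mul, zero_mul]
  -- Maximality is contradicted by adding to `e` the orthogonal idempotent `g * (1 - e)`, nonzero
  -- because `g ∈ (1 - e)cR`.
  have hee : (1 - e) * e = 0 := by rw [sub_mul, one_mul, he.eq, sub_self]
  have hef : e * (e + g * (1 - e)) = e := by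
    rw [mul_add, ← mul_assoc, heg, zero_mul, add_zero, he.eq]
  have hgf : (1 - e) * (e + g * (1 - e)) = g * (1 - e) := by
    rw [mul_add, hee, zero_add, sub_mul, one_mul, ← mul_assoc, heg, zero_mul, sub_zero]
  have hf : IsIdempotentElem (e + g * (1 - e)) := by
    rw [IsIdempotentElem, add_mul, hef, mul_assoc, hgf, ← mul_assoc, hg.eq]
  have hle := hmax ⟨e + g * (1 - e), hf, ⟨z + (x - z * c * x) * (1 - e), ?_⟩, rfl⟩
    (span_le_span_of_mul_eq hef)
  · have := mul_eq_self_of_span_le he hle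
    rw [add_mul, he.eq, mul_assoc, hee, mul_zero, add_right_inj] at this
    apply h0
    calc g = g * g := hg.eq.symm
      _ = g * (1 - e) * c * x := by nth_rewrite 2 [hx]; noncomm_ring
      _ = 0 := by rw [← this, zero_mul, zero_mul]
  · have : g = c * (x - z * c * x) := by rw [hx, hz]; noncomm_ring
    rw [mul_add, ← mul_assoc, ← this, ← hz]

/-- `H` says that right multiplication by `1 - g` is injective on `Re` modulo `J`. Regularity then
splits it, and the error `(1 - p) * e ∈ J` is absorbed by a unit. -/
theorem exists_mul_one_sub_mul_eq (h : CompatibleSystemsHaveMinimalLowerBounds R) {e g : R}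
    (he : IsIdempotentElem e)
    (H : ∀ z, z * e * (1 - g) ∈ Ring.jacobson R → z * e ∈ Ring.jacobson R) :
    ∃ t, e * (1 - g) * t = e := by
  obtain ⟨p, hp, ⟨w, hw⟩, hJ⟩ := h.exists_isIdempotentElem_one_sub_mul_mem (e * (1 - g))
  have hj : (1 - p) * e ∈ Ring.jacobson R := H _ (by rwa [mul_assoc])
  obtain ⟨v, hv, -⟩ := exists_inverse_one_sub_of_mem_jacobson hj
  have hep : e * p = p := by rw [hw, ← mul_assoc, ← mul_assoc, he.eq]
  have hpe : e * (1 - (1 - p) * e) = p * e := by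
    rw [mul_sub, ← mul_assoc, mul_sub, mul_one, hep, sub_mul, he.eq, sub_sub_cancel]
  refine ⟨w * e * v, ?_⟩
  calc e * (1 - g) * (w * e * v) = (e * (1 - g) * w) * e * v := by noncomm_ring
    _ = e := by rw [← hw, ← hpe, mul_assoc, hv, mul_one]

/-- Zorn is applied to directed sets of left ideals, not to the ideals themselves: a union of a
chain of such sets is again one, whereas a union of idempotent-generated ideals need not be
idempotent-generated. If essentiality fails at `x`, joining an idempotent `s * x` to every member
enlarges the set. -/
theorem exists_directedOn (h : CompatibleSystemsHaveMinimalLowerBounds R) (N : Ideal R) :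
    ∃ C : Set (Ideal R), C.Nonempty ∧ DirectedOn (· ≤ ·) C ∧
      (∀ L ∈ C, (∃ e, IsIdempotentElem e ∧ L = Ideal.span {e}) ∧ L ≤ N) ∧
      ∀ x ∈ N, x ∉ Ring.jacobson R →
        ∃ r, r * x ∉ Ring.jacobson R ∧ ∃ L ∈ C, ∃ l ∈ L, r * x - l ∈ Ring.jacobson R := by
  obtain ⟨C, hbot, ⟨hdir, hC⟩, hmax⟩ := zorn_subset_nonempty
    {C : Set (Ideal R) | DirectedOn (· ≤ ·) C ∧
      ∀ L ∈ C, (∃ e, IsIdempotentElem e ∧ L = Ideal.span {e}) ∧ L ≤ N}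
    (fun c hcS hc _ => ⟨⋃₀ c, ⟨Set.directedOn_sUnion hc.directedOn fun C hC => (hcS hC).1,
      fun L ⟨C, hC, hL⟩ => (hcS hC).2 L hL⟩, fun s hs => Set.subset_sUnion_of_mem hs⟩)
    {⊥} ⟨directedOn_singleton _, by
      rintro _ rfl
      exact ⟨⟨0, .zero, by simp⟩, bot_le⟩⟩
  refine ⟨C, ⟨⊥, hbot rfl⟩, hdir, hC, fun x hxN hxJ => ?_⟩
  by_contra! H
  obtain ⟨s, hs, hs0⟩ := h.exists_mul_isIdempotentElem_ne_zero hxJ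
  have hsJ := hs.notMem_jacobson hs0
  have hsN : s * x ∈ N := N.mul_mem_left s hxN
  have hsub : (· ⊔ Ideal.span {s * x}) '' C ⊆ C := by
    refine Set.subset_union_right.trans (hmax (y := C ∪ (· ⊔ Ideal.span {s * x}) '' C) ⟨?_, ?_⟩
      Set.subset_union_left)
    · have key : ∀ L ∈ C ∪ (· ⊔ Ideal.span {s * x}) '' C,
          ∃ M ∈ C, L ≤ M ⊔ Ideal.span {s * x} := by
        rintro L (hL | ⟨M, hM, rfl⟩)
        · exact ⟨L, hL, le_sup_left⟩
        · exact ⟨M, hM, le_rfl⟩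
      intro L₁ h₁ L₂ h₂
      obtain ⟨M₁, hM₁, hL₁⟩ := key L₁ h₁
      obtain ⟨M₂, hM₂, hL₂⟩ := key L₂ h₂
      obtain ⟨M, hM, h1, h2⟩ := hdir M₁ hM₁ M₂ hM₂
      exact ⟨M ⊔ Ideal.span {s * x}, .inr ⟨M, hM, rfl⟩, hL₁.trans (sup_le_sup_right h1 _),
        hL₂.trans (sup_le_sup_right h2 _)⟩
    · rintro L (hL | ⟨M, hM, rfl⟩)
      · exact hC L hL
      · obtain ⟨⟨e, he, rfl⟩, hMN⟩ := hC M hM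
        refine ⟨exists_span_sup_span_eq he hs (h.exists_mul_one_sub_mul_eq hs fun z hz => ?_),
          sup_le hMN ((Ideal.span_singleton_le_iff_mem _).2 hsN)⟩
        by_contra hzJ
        rw [← mul_assoc] at hzJ
        refine H (z * s) hzJ _ hM (z * s * x * e)
          (Ideal.mul_mem_left _ _ (Ideal.mem_span_singleton_self e)) ?_
        convert hz using 1
        noncomm_ring
  exact H s hsJ _ (hsub ⟨⊥, hbot rfl, rfl⟩) (s * x)
    (Submodule.mem_sup_right (Ideal.mem_span_singleton_self _)) (by simp)

/-- If `x * f ∉ J`, an idempotent `p ∈ x f R` makes right multiplication by `f` injective on `Rpx`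
modulo `J`; but `Rpx` meets some `L ∈ C` modulo `J`, and `f` kills `L`. -/
theorem mul_mem_jacobson_of_essential (h : CompatibleSystemsHaveMinimalLowerBounds R)
    {N : Ideal R} {C : Set (Ideal R)}
    (hC : ∀ x ∈ N, x ∉ Ring.jacobson R →
      ∃ r, r * x ∉ Ring.jacobson R ∧ ∃ L ∈ C, ∃ l ∈ L, r * x - l ∈ Ring.jacobson R)
    {f : R} (hf : ∀ L ∈ C, ∀ l ∈ L, l * f = 0) {x : R} (hx : x ∈ N) :
    x * f ∈ Ring.jacobson R := by
  by_contra hJ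
  obtain ⟨p, hp, hp0, w, hw⟩ := h.exists_isIdempotentElem_ne_zero hJ
  have hpJ := hp.notMem_jacobson hp0
  have key : ∀ r, r * p * x * f ∈ Ring.jacobson R → r * p ∈ Ring.jacobson R := fun r hr => by
    have : r * p = r * p * x * f * w := by
      calc r * p = r * (p * p) := by rw [hp.eq]
        _ = r * p * x * f * w := by nth_rewrite 2 [hw]; noncomm_ring
    rw [this]
    exact Ideal.mul_mem_right _ _ hr
  have hpx : p * x ∉ Ring.jacobson R := fun hpx => hpJ <| by
    simpa using key 1 (by simpa using Ideal.mul_mem_right f _ hpx)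
  obtain ⟨r, hr, L, hL, l, hl, hrl⟩ := hC (p * x) (N.mul_mem_left p hx) hpx
  rw [← mul_assoc] at hr hrl
  refine hr (Ideal.mul_mem_right _ _ (key r ?_))
  have := Ideal.mul_mem_right f _ hrl
  rwa [sub_mul, hf L hL l hl, sub_zero] at this

end CompatibleSystemsHaveMinimalLowerBounds

end Regularity

/-! ### Conditions (C2) and (C1) for the quotient. -/

section Continuity

variable {R : Type u} [Ring R]

namespace CompatibleSystemsHaveMinimalLowerBounds

theorem exists_mul_mul_eq_quotient (h : CompatibleSystemsHaveMinimalLowerBounds R)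
    (c : R ⧸ Ring.jacobson R) : ∃ w, c * w * c = c := by
  obtain ⟨c, rfl⟩ := Ideal.Quotient.mk_surjective c
  obtain ⟨e, -, ⟨x, hx⟩, hJ⟩ := h.exists_isIdempotentElem_one_sub_mul_mem c
  refine ⟨Ideal.Quotient.mk _ x, ?_⟩
  rw [← map_mul, ← map_mul, ← hx, Eq.comm, Ideal.Quotient.eq]
  rwa [sub_mul, one_mul] at hJ

theorem isComplemented_of_linearEquiv (h : CompatibleSystemsHaveMinimalLowerBounds R)
    {N K : Ideal (R ⧸ Ring.jacobson R)} (hK : IsComplemented K)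
    (φ : N ≃ₗ[R ⧸ Ring.jacobson R] K) : IsComplemented N := by
  obtain ⟨k, hk, hkK⟩ := exists_forall_mul_eq_of_isComplemented hK
  -- The preimage of the generator of `K` generates `N`; regularity turns it into an idempotent
  -- generator.
  obtain ⟨c, hc⟩ : ∃ c : N, c = φ.symm ⟨k, hk⟩ := ⟨_, rfl⟩
  have hN : N = Ideal.span {(c : R ⧸ Ring.jacobson R)} := by
    refine le_antisymm (fun n hn => ?_) ((Ideal.span_singleton_le_iff_mem _).2 c.2)
    rw [Ideal.mem_span_singleton']
    refine ⟨φ ⟨n, hn⟩, ?_⟩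
    have h1 : (φ ⟨n, hn⟩ : R ⧸ Ring.jacobson R) • (⟨k, hk⟩ : K) = φ ⟨n, hn⟩ :=
      Subtype.ext (hkK _ (φ ⟨n, hn⟩).2)
    have h2 := congrArg φ.symm h1
    rw [map_smul, ← hc, φ.symm_apply_apply] at h2
    exact congrArg Subtype.val h2
  obtain ⟨w, hw⟩ := h.exists_mul_mul_eq_quotient (c : R ⧸ Ring.jacobson R)
  have hid : IsIdempotentElem (w * (c : R ⧸ Ring.jacobson R)) := by
    rw [IsIdempotentElem, mul_assoc, ← mul_assoc (c : R ⧸ Ring.jacobson R), hw]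
  have hspan : N = Ideal.span {w * (c : R ⧸ Ring.jacobson R)} := by
    refine hN.trans (le_antisymm (span_le_span_of_mul_eq (by rw [← mul_assoc, hw])) ?_)
    rw [Ideal.span_singleton_le_iff_mem]
    exact Ideal.mul_mem_left _ _ (Ideal.mem_span_singleton_self _)
  rw [hspan]
  exact hid.isComplemented_span

/-- Two left ideals of `R ⧸ J` with zero intersection are separated by an idempotent. -/
theorem exists_isIdempotentElem_of_disjoint (h : CompatibleSystemsHaveMinimalLowerBounds R)
    {N M : Ideal (R ⧸ Ring.jacobson R)} (hNM : Disjoint N M) :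
    ∃ e, IsIdempotentElem e ∧ (∀ x ∈ N, x * e = x) ∧ ∀ x ∈ M, x * e = 0 := by
  set π := Ideal.Quotient.mk (Ring.jacobson R) with hπ
  obtain ⟨C, hC0, hCdir, hC, hCess⟩ := h.exists_directedOn (N.comap π)
  obtain ⟨D, hD0, hDdir, hD, hDess⟩ := h.exists_directedOn (M.comap π)
  choose E hE hCE using fun L : C => (hC L L.2).1
  choose G hG hDG using fun L : D => (hD L L.2).1
  have hEN : ∀ L, π (E L) ∈ N := fun L => (hC L L.2).2 <| by
    rw [hCE L]; exact Ideal.mem_span_singleton_self _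
  have hGM : ∀ L, π (G L) ∈ M := fun L => (hD L L.2).2 <| by
    rw [hDG L]; exact Ideal.mem_span_singleton_self _
  have hmono : ∀ {e f : R}, IsIdempotentElem f → Ideal.span {e} ≤ Ideal.span {f} →
      1 - f = (1 - e) * (1 - f) := fun {e f} hf hle => by
    rw [sub_mul, one_mul, mul_sub, mul_one, mul_eq_self_of_span_le hf hle, sub_self, sub_zero]
  have hEmono : ∀ i j : C × D, i < j → 1 - E j.1 = (1 - E i.1) * (1 - E j.1) := fun i j hij =>
    hmono (hE _) (by rw [← hCE, ← hCE]; exact hij.le.1)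
  have hGmono : ∀ i j : C × D, i < j → 1 - G j.2 = (1 - G i.2) * (1 - G j.2) := fun i j hij =>
    hmono (hG _) (by rw [← hDG, ← hDG]; exact hij.le.2)
  have hcop : ∀ i : C × D, ∃ u v, (1 - E i.1) * u + (1 - G i.2) * v = 1 := by
    rintro ⟨L, L'⟩
    obtain ⟨t, ht⟩ := h.exists_mul_one_sub_mul_eq (e := E L) (g := G L') (hE L) (by
      intro z hz
      rw [← Ideal.Quotient.eq_zero_iff_mem] at hz ⊢
      rw [mul_sub, mul_one, map_sub, sub_eq_zero] at hz
      -- Modulo `J`, `z * E L = z * E L * G L'` lies in both `N` and `M`.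
      refine Submodule.disjoint_def.1 hNM _ ?_ ?_
      · rw [map_mul]
        exact N.mul_mem_left _ (hEN L)
      · rw [hz, map_mul]
        exact M.mul_mem_left _ (hGM L'))
    refine ⟨1 - (1 - G L') * t, t, ?_⟩
    calc _ = 1 - E L + E L * (1 - G L') * t := by noncomm_ring
      _ = 1 := by rw [ht, sub_add_cancel]
  have : Nonempty C := hC0.to_subtype
  have : Nonempty D := hD0.to_subtype
  have : IsDirectedOrder C := directedOn_iff_isDirectedOrder.1 hCdir
  have : IsDirectedOrder D := directedOn_iff_isDirectedOrder.1 hDdir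
  have : IsDirectedOrder (C × D) := ⟨fun i j =>
    let ⟨L, h1, h2⟩ := exists_ge_ge i.1 j.1
    let ⟨L', h1', h2'⟩ := exists_ge_ge i.2 j.2
    ⟨(L, L'), ⟨h1, h1'⟩, ⟨h2, h2'⟩⟩⟩
  obtain ⟨f, hf, H⟩ := h.exists_isIdempotentElem (I := C × D) (fun i => 1 - E i.1)
    (fun i => 1 - G i.2) (fun _ j => 1 - E j.1) (fun _ j => 1 - G j.2) hcop hEmono hGmono
    (fun i j k _ hjk => hEmono j k hjk) (fun i j k _ hjk => hGmono j k hjk)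
  have hkill : ∀ {e g : R}, IsIdempotentElem e → (∃ y, g = (1 - e) * y) →
      ∀ l ∈ Ideal.span {e}, l * g = 0 := by
    rintro e g he ⟨y, rfl⟩ l hl
    rw [← mul_eq_self_of_mem_span he hl, mul_assoc, ← mul_assoc e, mul_sub, mul_one, he.eq,
      sub_self, zero_mul, mul_zero]
  have hNf : ∀ x ∈ N.comap π, x * f ∈ Ring.jacobson R := fun x hx =>
    h.mul_mem_jacobson_of_essential hCess (fun L hL l hl =>
      hkill (hE ⟨L, hL⟩) (H (⟨L, hL⟩, Classical.arbitrary D)).1 l (by rwa [← hCE])) hx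
  have hMf : ∀ x ∈ M.comap π, x * (1 - f) ∈ Ring.jacobson R := fun x hx =>
    h.mul_mem_jacobson_of_essential hDess (fun L hL l hl =>
      hkill (hG ⟨L, hL⟩) (H (Classical.arbitrary C, ⟨L, hL⟩)).2 l (by rwa [← hDG])) hx
  refine ⟨π (1 - f), hf.one_sub.map π, fun x hx => ?_, fun x hx => ?_⟩
  · obtain ⟨x, rfl⟩ := Ideal.Quotient.mk_surjective x
    have := Ideal.Quotient.eq_zero_iff_mem.2 (hNf x hx)
    rw [map_mul] at this
    rw [map_sub, map_one, mul_sub, mul_one, hπ, this, sub_zero]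
  · obtain ⟨x, rfl⟩ := Ideal.Quotient.mk_surjective x
    rw [hπ, ← map_mul]
    exact Ideal.Quotient.eq_zero_iff_mem.2 (hMf x hx)

theorem exists_isComplemented_isEssentialIn (h : CompatibleSystemsHaveMinimalLowerBounds R)
    (N : Ideal (R ⧸ Ring.jacobson R)) : ∃ K, IsComplemented K ∧ IsEssentialIn N K := by
  obtain ⟨M, hNM, hmax⟩ := zorn_le₀ {M | Disjoint N M} (fun C hCS hC =>
    ⟨sSup C, hC.directedOn.disjoint_sSup_right.2 fun M hM => hCS hM, fun M hM => le_sSup hM⟩)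
  obtain ⟨e, he, hN, hM⟩ := h.exists_isIdempotentElem_of_disjoint hNM
  refine ⟨Ideal.span {e}, he.isComplemented_span, fun n hn => ?_, fun L hL hNL => ?_⟩
  · exact Ideal.mem_span_singleton'.2 ⟨n, hN n hn⟩
  · have hdisj : Disjoint N (M ⊔ L) := by
      rw [Submodule.disjoint_def]
      intro n hn hn'
      obtain ⟨m, hm, l, hl, rfl⟩ := Submodule.mem_sup.1 hn'
      have hml := hN _ hn
      rw [add_mul, hM m hm, zero_add, mul_eq_self_of_mem_span he (hL hl)] at hml
      rw [← hml] at hn ⊢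
      exact Submodule.disjoint_def.1 (disjoint_iff.2 hNL) l hn hl
    rw [eq_bot_iff]
    intro l hl
    rw [Submodule.mem_bot, ← mul_eq_self_of_mem_span he (hL hl)]
    exact hM l (hmax hdisj le_sup_left (Submodule.mem_sup_right hl))

end CompatibleSystemsHaveMinimalLowerBounds

end Continuity

theorem theoremt (R : Type u) [Ring R] (h : CompatibleSystemsHaveMinimalLowerBounds R) :
    IsLeftContinuousRing (R ⧸ Ring.jacobson R) where
  c1 := h.exists_isComplemented_isEssentialIn
  c2 _ _ hK := fun ⟨φ⟩ => h.isComplemented_of_linearEquiv hK φ
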